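/- Let $\mathbb D=\{z\in\mathbb C:|z|<1\}$ and let $\mathcal A$ be the class of analytic functions $f(z)=z+\sum_{n\ge2}a_nz^n$ on $\mathbb D$; put $a_1=1$. For analytic functions $h,g$ on $\mathbb D$ write $h\prec g$ if there is an analytic function $w$ on $\mathbb D$ with $w(0)=0$, $|w(z)|\le|z|$ and $h(z)=g(w(z))$ for all $z\in\mathbb D$. Let $\mathcal C_{\mathcal B}$ be the class of all $f\in\mathcal A$ such that $$1+\frac{zf''(z)}{f'(z)}\prec\sqrt{1+\tanh z}$$ (principal branch of the square root), and for $f\in\mathcal A$ let $$H_3(1)=\begin{vmatrix}a_1&a_2&a_3\\a_2&a_3&a_4\\a_3&a_4&a_5\end{vmatrix}=2a_2a_3a_4-a_3^3-a_4^2-a_2^2a_5+a_3a_5 .$$ Then $|H_3(1)|\le \frac1{576}$ for every $f\in\mathcal C_{\mathcal B}$. The bound is sharp: the function $$f_1(z)=\int_0^z\exp\left(\int_0^t\frac{\sqrt{1+\tanh (u^3)}-1}{u}\,du\right)dt$$ belongs to $\mathcal C_{\mathcal B}$ and satisfies $|H_3(1)|=\frac1{576}$. -/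

import Mathlib

noncomputable section

namespace BeanConvex

/-- The open unit disk of the complex plane. -/
def unitDisk : Set ℂ := Metric.ball 0 1

/-- The class `𝒜` of normalized analytic functions on the open unit disk,
`f z = z + a₂ z² + a₃ z³ + ⋯`. Only the values on the disk matter. -/
def ClassA : Set (ℂ → ℂ) :=
  {f | DifferentiableOn ℂ f unitDisk ∧ f 0 = 0 ∧ deriv f 0 = 1}

/-- The `n`-th Taylor coefficient of `f` at the origin. -/
def taylorCoeff (f : ℂ → ℂ) (n : ℕ) : ℂ := iteratedDeriv n f 0 / (n.factorial : ℂ)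

/-- The Hankel determinant `H_q(n)` of `f`: the determinant of the `q × q` matrix whose entry
in row `i` and column `j` (counted from zero) is the Taylor coefficient `a_{n+i+j}`. -/
def hankelDet (q n : ℕ) (f : ℂ → ℂ) : ℂ :=
  Matrix.det (Matrix.of fun i j : Fin q => taylorCoeff f (n + (i : ℕ) + (j : ℕ)))

/-- A Schwarz function: analytic on the unit disk with `w 0 = 0` and `|w z| ≤ |z|`. -/
def IsSchwarz (w : ℂ → ℂ) : Prop :=
  DifferentiableOn ℂ w unitDisk ∧ w 0 = 0 ∧ ∀ z ∈ unitDisk, ‖w z‖ ≤ ‖z‖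

/-- Subordination `h ≺ g` of analytic functions on the unit disk. -/
def Subordinate (h g : ℂ → ℂ) : Prop :=
  DifferentiableOn ℂ h unitDisk ∧ DifferentiableOn ℂ g unitDisk ∧
    ∃ w, IsSchwarz w ∧ ∀ z ∈ unitDisk, h z = g (w z)

/-- The function `√(1 + tanh z)` (principal branch), mapping the unit disk onto a bean-shaped
domain. -/
def beanMap (z : ℂ) : ℂ := Complex.sqrt (1 + Complex.tanh z)

/-- The class `𝒞_ℬ` of all `f ∈ 𝒜` with `1 + z f''(z) / f'(z) ≺ √(1 + tanh z)`. -/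
def ClassCB : Set (ℂ → ℂ) :=
  {f | f ∈ ClassA ∧ Subordinate (fun z => 1 + z * deriv (deriv f) z / deriv f z) beanMap}

/-- The integral `∫₀ᶻ g(u) du` along the line segment from `0` to `z`. -/
def segmentIntegral (g : ℂ → ℂ) (z : ℂ) : ℂ := z * ∫ s in (0 : ℝ)..1, g ((s : ℂ) * z)

/-- The function `f₁(z) = ∫₀ᶻ exp (∫₀ᵗ (√(1 + tanh u³) - 1) / u du) dt`. The inner integrand has
a removable singularity at `u = 0` with value `0`, which is what division by zero returns. -/
def extremalFun : ℂ → ℂ :=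
  segmentIntegral fun t => Complex.exp (segmentIntegral (fun u => (beanMap (u ^ 3) - 1) / u) t)

end BeanConvex

end

/-!
Write `w z = ∑ cₙ zⁿ` for the Schwarz function of `f ∈ 𝒞_ℬ`. The power series `T` of `tanh ∘ w` and
`Q` of `√(1 + tanh ∘ w)` are determined by `T' = (1 - T²) w'` and `Q² = 1 + T`, and comparing
coefficients in `z f'' = f' (Q - 1)` expresses `a₂, …, a₅` through `c₁, …, c₄`. In these terms
`576 H₃(1) = -c₃² + ⋯`. The only information needed about `w` is Gutzmer's inequality
`∑ |cₙ|² ≤ 1`, which is Parseval's identity on circles of radius tending to `1`: by Young's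
inequality, all monomials other than `c₃²` add up to at most `|c₁|² + |c₂|² + |c₄|² ≤ 1 - |c₃|²`.
Equality holds for `w z = z³`.
-/

noncomputable section

namespace BeanConvex

open Complex Filter MeasureTheory Metric PowerSeries Set
open scoped Real Topology

/-! ### Taylor series as formal power series -/

/-- The Taylor series of `f` at the origin as a formal power series. It turns differential
equations satisfied by analytic functions into equations in `ℂ⟦X⟧`. -/
def taylorSeries (f : ℂ → ℂ) : ℂ⟦X⟧ := .mk (taylorCoeff f)

@[simp]
theorem coeff_taylorSeries (f : ℂ → ℂ) (n : ℕ) : coeff n (taylorSeries f) = taylorCoeff f n :=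
  coeff_mk _ _

theorem taylorCoeff_zero (f : ℂ → ℂ) : taylorCoeff f 0 = f 0 := by simp [taylorCoeff]

theorem taylorCoeff_one (f : ℂ → ℂ) : taylorCoeff f 1 = deriv f 0 := by simp [taylorCoeff]

theorem taylorCoeff_pow (k n : ℕ) :
    taylorCoeff (fun z => z ^ k) n = if n = k then 1 else 0 := by
  rw [taylorCoeff, iteratedDeriv_fun_pow_zero]
  split_ifs with h
  · rw [h, div_self (by exact_mod_cast k.factorial_ne_zero)]
  · simp

theorem taylorSeries_congr {f g : ℂ → ℂ} (h : f =ᶠ[𝓝 0] g) : taylorSeries f = taylorSeries g := by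
  ext n
  simp only [coeff_taylorSeries, taylorCoeff, h.iteratedDeriv_eq]

theorem taylorSeries_one : taylorSeries (fun _ => 1) = 1 := by
  ext n
  simpa [coeff_one] using taylorCoeff_pow 0 n

theorem taylorSeries_id : taylorSeries (fun z => z) = X := by
  ext n
  simpa [coeff_X] using taylorCoeff_pow 1 n

theorem taylorSeries_add {f g : ℂ → ℂ} (hf : AnalyticAt ℂ f 0) (hg : AnalyticAt ℂ g 0) :
    taylorSeries (fun z => f z + g z) = taylorSeries f + taylorSeries g := by
  ext n
  simp only [map_add, coeff_taylorSeries, taylorCoeff,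
    iteratedDeriv_fun_add hf.contDiffAt hg.contDiffAt, add_div]

theorem taylorSeries_sub {f g : ℂ → ℂ} (hf : AnalyticAt ℂ f 0) (hg : AnalyticAt ℂ g 0) :
    taylorSeries (fun z => f z - g z) = taylorSeries f - taylorSeries g := by
  ext n
  simp only [map_sub, coeff_taylorSeries, taylorCoeff,
    iteratedDeriv_fun_sub hf.contDiffAt hg.contDiffAt, sub_div]

theorem taylorSeries_mul {f g : ℂ → ℂ} (hf : AnalyticAt ℂ f 0) (hg : AnalyticAt ℂ g 0) :
    taylorSeries (fun z => f z * g z) = taylorSeries f * taylorSeries g := by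
  ext n
  rw [coeff_mul, Finset.Nat.sum_antidiagonal_eq_sum_range_succ_mk]
  simp only [coeff_taylorSeries, taylorCoeff]
  rw [iteratedDeriv_fun_mul hf.contDiffAt hg.contDiffAt, Finset.sum_div]
  refine Finset.sum_congr rfl fun i hi => ?_
  have hfact (m : ℕ) : (m.factorial : ℂ) ≠ 0 := by exact_mod_cast m.factorial_ne_zero
  rw [Nat.cast_choose ℂ (Finset.mem_range_succ_iff.1 hi)]
  field_simp [hfact]

theorem taylorSeries_deriv (f : ℂ → ℂ) : taylorSeries (deriv f) = d⁄dX ℂ (taylorSeries f) := by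
  ext n
  rw [coeff_derivative]
  simp only [coeff_taylorSeries, taylorCoeff]
  rw [← iteratedDeriv_succ', Nat.factorial_succ]
  have hfact : (n.factorial : ℂ) ≠ 0 := by exact_mod_cast n.factorial_ne_zero
  have hsucc : (n : ℂ) + 1 ≠ 0 := by exact_mod_cast n.succ_ne_zero
  push_cast
  field_simp

/-! ### Gutzmer's inequality -/

theorem fourier_neg_eq_pow_div_circleMap_pow {r : ℝ} (hr : r ≠ 0) (n : ℕ) (θ : ℝ) :
    fourier (-n : ℤ) (θ : AddCircle (2 * π - 0)) = (r : ℂ) ^ n / circleMap 0 r θ ^ n := by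
  have hr' : (r : ℂ) ≠ 0 := by exact_mod_cast hr
  have hpi : (π : ℂ) ≠ 0 := by exact_mod_cast Real.pi_ne_zero
  rw [fourier_coe_apply, circleMap_zero, mul_pow, ← exp_nat_mul,
    div_mul_cancel_left₀ (by positivity), ← exp_neg]
  congr 1
  push_cast
  field_simp
  ring

theorem fourierCoeffOn_comp_circleMap {f : ℂ → ℂ} {r : ℝ} (hr : 0 < r)
    (hf : DiffContOnCl ℂ f (ball 0 r)) (n : ℕ) :
    fourierCoeffOn Real.two_pi_pos (fun θ => f (circleMap 0 r θ)) n = taylorCoeff f n * r ^ n := by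
  have hr' : (r : ℂ) ≠ 0 := by exact_mod_cast hr.ne'
  have hpi : (π : ℂ) ≠ 0 := by exact_mod_cast Real.pi_ne_zero
  have hfact : (n.factorial : ℂ) ≠ 0 := by exact_mod_cast n.factorial_ne_zero
  have integrand (θ : ℝ) : deriv (circleMap 0 r) θ • (1 / (circleMap 0 r θ - 0) ^ (n + 1)) •
      f (circleMap 0 r θ) = I / r ^ n *
        (fourier (-n : ℤ) (θ : AddCircle (2 * π - 0)) • f (circleMap 0 r θ)) := by
    have hcircle : circleMap 0 r θ ≠ 0 := circleMap_ne_center hr.ne'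
    rw [fourier_neg_eq_pow_div_circleMap_pow hr.ne', deriv_circleMap, sub_zero]
    simp only [smul_eq_mul]
    field_simp
    ring
  have cauchy := hf.circleIntegral_one_div_sub_center_pow_smul hr n
  simp_rw [circleIntegral, integrand, intervalIntegral.integral_const_mul, smul_eq_mul] at cauchy
  rw [fourierCoeffOn_eq_integral, taylorCoeff, real_smul]
  simp only [smul_eq_mul, sub_zero] at cauchy ⊢
  push_cast
  field_simp at cauchy ⊢
  linear_combination cauchy

theorem sum_norm_taylorCoeff_mul_pow_sq_le_of_sphere {f : ℂ → ℂ} {r M : ℝ} (hr : 0 < r)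
    (hf : DiffContOnCl ℂ f (ball 0 r)) (hM : ∀ z ∈ sphere 0 r, ‖f z‖ ≤ M) (s : Finset ℕ) :
    ∑ n ∈ s, (‖taylorCoeff f n‖ * r ^ n) ^ 2 ≤ M ^ 2 := by
  have hbound (θ : ℝ) : ‖f (circleMap 0 r θ)‖ ≤ M := hM _ (circleMap_mem_sphere 0 hr.le θ)
  have hcont : Continuous fun θ => f (circleMap 0 r θ) :=
    hf.continuousOn_ball.comp_continuous (continuous_circleMap 0 r)
      fun θ => circleMap_mem_closedBall 0 hr.le θ
  have parseval := hasSum_sq_fourierCoeffOn Real.two_pi_pos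
    (MemLp.of_bound hcont.aestronglyMeasurable M (.of_forall hbound))
  calc ∑ n ∈ s, (‖taylorCoeff f n‖ * r ^ n) ^ 2
      = ∑ k ∈ s.map Nat.castEmbedding,
          ‖fourierCoeffOn Real.two_pi_pos (fun θ => f (circleMap 0 r θ)) k‖ ^ 2 := by
        simp [fourierCoeffOn_comp_circleMap hr hf, abs_of_pos hr]
    _ ≤ (2 * π - 0)⁻¹ • ∫ θ in 0..2 * π, ‖f (circleMap 0 r θ)‖ ^ 2 :=
        sum_le_hasSum _ (fun _ _ => by positivity) parseval
    _ ≤ (2 * π - 0)⁻¹ • ∫ _ in 0..2 * π, M ^ 2 := by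
        gcongr
        · simpa using Real.pi_pos.le
        · exact intervalIntegral.integral_mono_on Real.two_pi_pos.le
            ((hcont.norm.pow 2).intervalIntegrable _ _) (by simp)
            fun θ _ => pow_le_pow_left₀ (norm_nonneg _) (hbound θ) 2
    _ = M ^ 2 := by
        rw [intervalIntegral.integral_const, inv_smul_smul₀ (by simp)]

theorem sum_norm_taylorCoeff_mul_pow_sq_le {f : ℂ → ℂ} {R M : ℝ} (hR : 0 < R)
    (hf : DifferentiableOn ℂ f (ball 0 R)) (hM : ∀ z ∈ ball 0 R, ‖f z‖ ≤ M) (s : Finset ℕ) :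
    ∑ n ∈ s, (‖taylorCoeff f n‖ * R ^ n) ^ 2 ≤ M ^ 2 := by
  have hlim : Tendsto (fun r : ℝ => ∑ n ∈ s, (‖taylorCoeff f n‖ * r ^ n) ^ 2) (𝓝[<] R)
      (𝓝 (∑ n ∈ s, (‖taylorCoeff f n‖ * R ^ n) ^ 2)) :=
    (Continuous.tendsto (by fun_prop) R).mono_left nhdsWithin_le_nhds
  refine le_of_tendsto hlim ?_
  filter_upwards [Ioo_mem_nhdsLT hR] with r hr
  have hsub : closedBall (0 : ℂ) r ⊆ ball 0 R := closedBall_subset_ball hr.2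
  exact sum_norm_taylorCoeff_mul_pow_sq_le_of_sphere hr.1 (hf.diffContOnCl_ball hsub)
    (fun z hz => hM z (hsub (sphere_subset_closedBall hz))) s

/-! ### Comparison of coefficients -/

section Coefficients

variable {K : Type*} [Field K] [CharZero K]

theorem coeff_of_derivative_eq_one_sub_mul_self {T W : K⟦X⟧}
    (hT : d⁄dX K T = (1 - T * T) * d⁄dX K W) (hT0 : coeff 0 T = 0) :
    coeff 1 T = coeff 1 W ∧ coeff 2 T = coeff 2 W ∧
      coeff 3 T = coeff 3 W - coeff 1 W ^ 3 / 3 ∧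
      coeff 4 T = coeff 4 W - coeff 1 W ^ 2 * coeff 2 W := by
  have h (n : ℕ) := congrArg (coeff n) hT
  simp only [coeff_mul, coeff_derivative, coeff_one, map_sub,
    Finset.Nat.sum_antidiagonal_eq_sum_range_succ_mk] at h
  have h0 := h 0
  have h1 := h 1
  have h2 := h 2
  have h3 := h 3
  norm_num [Finset.sum_range_succ, hT0] at h0 h1 h2 h3
  rw [h0] at h2 h3
  rw [h1] at h3
  exact ⟨h0, h1, by linear_combination h2 / 3, by linear_combination h3 / 4⟩

theorem coeff_of_mul_self_eq_one_add {Q T : K⟦X⟧} (hQ : Q * Q = 1 + T) (hQ0 : coeff 0 Q = 1) :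
    coeff 1 Q = coeff 1 T / 2 ∧ coeff 2 Q = coeff 2 T / 2 - coeff 1 T ^ 2 / 8 ∧
      coeff 3 Q = coeff 3 T / 2 - coeff 1 T * coeff 2 T / 4 + coeff 1 T ^ 3 / 16 ∧
      coeff 4 Q = coeff 4 T / 2 - coeff 1 T * coeff 3 T / 4 - coeff 2 T ^ 2 / 8
        + 3 / 16 * coeff 1 T ^ 2 * coeff 2 T - 5 / 128 * coeff 1 T ^ 4 := by
  have h (n : ℕ) := congrArg (coeff n) hQ
  simp only [coeff_mul, coeff_one, map_add,
    Finset.Nat.sum_antidiagonal_eq_sum_range_succ_mk] at h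
  have h1 := h 1
  have h2 := h 2
  have h3 := h 3
  have h4 := h 4
  norm_num [Finset.sum_range_succ, hQ0] at h1 h2 h3 h4
  have q1 : coeff 1 Q = coeff 1 T / 2 := by linear_combination h1 / 2
  rw [q1] at h2 h3 h4
  have q2 : coeff 2 Q = coeff 2 T / 2 - coeff 1 T ^ 2 / 8 := by linear_combination h2 / 2
  rw [q2] at h3 h4
  have q3 : coeff 3 Q = coeff 3 T / 2 - coeff 1 T * coeff 2 T / 4 + coeff 1 T ^ 3 / 16 := by
    linear_combination h3 / 2
  rw [q3] at h4
  exact ⟨q1, q2, q3, by linear_combination h4 / 2⟩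

theorem coeff_of_X_mul_derivative_derivative_eq {F Q : K⟦X⟧}
    (hF : X * d⁄dX K (d⁄dX K F) = d⁄dX K F * (Q - 1)) (hF1 : coeff 1 F = 1) :
    coeff 2 F = coeff 1 Q / 2 ∧ coeff 3 F = (coeff 1 Q ^ 2 + coeff 2 Q) / 6 ∧
      coeff 4 F = coeff 1 Q ^ 3 / 24 + coeff 1 Q * coeff 2 Q / 8 + coeff 3 Q / 12 ∧
      coeff 5 F = coeff 1 Q ^ 4 / 120 + coeff 1 Q ^ 2 * coeff 2 Q / 20
        + coeff 1 Q * coeff 3 Q / 15 + coeff 2 Q ^ 2 / 40 + coeff 4 Q / 20 := by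
  have hQ0 : coeff 0 Q = 1 := by
    have hF' : constantCoeff (d⁄dX K F) = 1 := by
      simp [← coeff_zero_eq_constantCoeff_apply, coeff_derivative, hF1]
    have h := congrArg constantCoeff hF
    rw [map_mul, map_mul, constantCoeff_X, zero_mul, hF', one_mul, map_sub, map_one] at h
    rw [coeff_zero_eq_constantCoeff_apply]
    exact sub_eq_zero.1 h.symm
  have h (n : ℕ) := congrArg (coeff (n + 1)) hF
  simp only [coeff_succ_X_mul] at h
  simp only [coeff_mul, coeff_derivative, coeff_one, map_sub,
    Finset.Nat.sum_antidiagonal_eq_sum_range_succ_mk] at h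
  have h0 := h 0
  have h1 := h 1
  have h2 := h 2
  have h3 := h 3
  norm_num [Finset.sum_range_succ, hF1, hQ0] at h0 h1 h2 h3
  have f2 : coeff 2 F = coeff 1 Q / 2 := by linear_combination h0 / 2
  rw [f2] at h1 h2 h3
  have f3 : coeff 3 F = (coeff 1 Q ^ 2 + coeff 2 Q) / 6 := by linear_combination h1 / 6
  rw [f3] at h2 h3
  have f4 : coeff 4 F = coeff 1 Q ^ 3 / 24 + coeff 1 Q * coeff 2 Q / 8 + coeff 3 Q / 12 := by
    linear_combination h2 / 12
  rw [f4] at h3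
  exact ⟨f2, f3, f4, by linear_combination h3 / 20⟩

end Coefficients

/-! ### The bean map -/

theorem isOpen_unitDisk : IsOpen unitDisk := isOpen_ball

theorem unitDisk_mem_nhds_zero : unitDisk ∈ 𝓝 0 := ball_mem_nhds 0 one_pos

theorem abs_im_lt_pi_div_two_of_mem_unitDisk {z : ℂ} (hz : z ∈ unitDisk) : |z.im| < π / 2 := by
  have h1 : |z.im| < 1 := (abs_im_le_norm z).trans_lt (mem_ball_zero_iff.1 hz)
  linarith [Real.pi_gt_three]

theorem one_add_exp_neg_two_mul_mem_slitPlane {z : ℂ} (hz : |z.im| < π / 2) :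
    1 + exp (-(2 * z)) ∈ slitPlane := by
  rw [abs_lt] at hz
  have hexp : exp (-(2 * z)) ∈ slitPlane := by
    have him : (-(2 * z)).im ∈ Ioo (-π) π := by
      constructor <;> simp <;> linarith
    rw [exp_mem_slitPlane, (toIocMod_eq_self Real.two_pi_pos).2 ⟨him.1, by linarith [him.2]⟩]
    exact him.2.ne
  rw [mem_slitPlane_iff] at hexp ⊢
  refine hexp.imp (fun h => ?_) fun h => ?_
  · rw [add_re, one_re]
    positivity
  · simpa using h

theorem one_add_exp_neg_two_mul (z : ℂ) : 1 + exp (-(2 * z)) = 2 * cosh z * exp (-z) := by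
  rw [two_cosh, add_mul, ← exp_add, ← exp_add, add_neg_cancel, exp_zero, ← two_mul, mul_neg]

theorem cosh_ne_zero_of_abs_im_lt {z : ℂ} (hz : |z.im| < π / 2) : cosh z ≠ 0 := by
  have h := slitPlane_ne_zero (one_add_exp_neg_two_mul_mem_slitPlane hz)
  rw [one_add_exp_neg_two_mul] at h
  exact right_ne_zero_of_mul (left_ne_zero_of_mul h)

theorem one_add_tanh {z : ℂ} (hz : cosh z ≠ 0) : 1 + tanh z = 2 / (1 + exp (-(2 * z))) := by
  rw [one_add_exp_neg_two_mul, exp_neg, tanh_eq_sinh_div_cosh, one_add_div hz, cosh_add_sinh]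
  field_simp

theorem one_add_tanh_mem_slitPlane {z : ℂ} (hz : |z.im| < π / 2) : 1 + tanh z ∈ slitPlane := by
  have h := one_add_exp_neg_two_mul_mem_slitPlane hz
  have hpos : 0 < normSq (1 + exp (-(2 * z))) := normSq_pos.2 (slitPlane_ne_zero h)
  rw [mem_slitPlane_iff] at h
  rw [one_add_tanh (cosh_ne_zero_of_abs_im_lt hz), mem_slitPlane_iff, div_re, div_im]
  refine h.imp (fun h => ?_) fun h => ?_
  · simp only [re_ofNat, im_ofNat, zero_mul, zero_div, add_zero]
    positivity
  · simpa [hpos.ne'] using h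

theorem hasDerivAt_tanh {z : ℂ} (hz : cosh z ≠ 0) :
    HasDerivAt tanh (1 - tanh z * tanh z) z := by
  refine ((hasDerivAt_sinh z).div (hasDerivAt_cosh z) hz).congr_deriv ?_
  rw [tanh_eq_sinh_div_cosh]
  field_simp

theorem analyticAt_tanh {z : ℂ} (hz : cosh z ≠ 0) : AnalyticAt ℂ tanh z :=
  analyticAt_sinh.div analyticAt_cosh hz

theorem differentiableOn_beanMap : DifferentiableOn ℂ beanMap unitDisk := fun z hz => by
  have him := abs_im_lt_pi_div_two_of_mem_unitDisk hz
  have htanh := (hasDerivAt_tanh (cosh_ne_zero_of_abs_im_lt him)).differentiableAt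
  exact ((differentiableAt_sqrt (one_add_tanh_mem_slitPlane him)).comp z
    (htanh.const_add 1)).differentiableWithinAt

theorem beanMap_mul_self (z : ℂ) : beanMap z * beanMap z = 1 + tanh z := by
  rw [beanMap, Complex.sqrt, ← sq]
  exact_mod_cast cpow_nat_inv_pow (1 + tanh z) two_ne_zero

theorem beanMap_zero : beanMap 0 = 1 := by simp [beanMap]

/-! ### The Hankel determinant in terms of the Schwarz function -/

section LocalExpansion

variable {f w : ℂ → ℂ}

theorem analyticAt_beanMap_comp (hw : AnalyticAt ℂ w 0) (hw0 : w 0 ∈ unitDisk) :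
    AnalyticAt ℂ (fun z => beanMap (w z)) 0 :=
  (differentiableOn_beanMap.analyticAt (isOpen_unitDisk.mem_nhds hw0)).comp hw

theorem derivative_taylorSeries_tanh_comp (hw : AnalyticAt ℂ w 0) (hw0 : cosh (w 0) ≠ 0) :
    d⁄dX ℂ (taylorSeries fun z => tanh (w z)) =
      (1 - taylorSeries (fun z => tanh (w z)) * taylorSeries fun z => tanh (w z)) *
        d⁄dX ℂ (taylorSeries w) := by
  have hT : AnalyticAt ℂ (fun z => tanh (w z)) 0 := (analyticAt_tanh hw0).comp hw
  have hderiv : deriv (fun z => tanh (w z)) =ᶠ[𝓝 0]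
      fun z => (1 - tanh (w z) * tanh (w z)) * deriv w z := by
    have hcosh := (analyticAt_cosh.comp hw).continuousAt.eventually_ne hw0
    filter_upwards [hw.eventually_analyticAt, hcosh] with z hwz hz
      using ((hasDerivAt_tanh hz).comp z hwz.differentiableAt.hasDerivAt).deriv
  rw [← taylorSeries_deriv, ← taylorSeries_deriv, taylorSeries_congr hderiv,
    taylorSeries_mul (analyticAt_const.fun_sub (hT.fun_mul hT)) hw.deriv,
    taylorSeries_sub analyticAt_const (hT.fun_mul hT), taylorSeries_mul hT hT, taylorSeries_one]

theorem taylorSeries_beanMap_comp_mul_self (hw : AnalyticAt ℂ w 0) (hw0 : w 0 ∈ unitDisk) :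
    taylorSeries (fun z => beanMap (w z)) * taylorSeries (fun z => beanMap (w z)) =
      1 + taylorSeries fun z => tanh (w z) := by
  have hQ := analyticAt_beanMap_comp hw hw0
  have hT : AnalyticAt ℂ (fun z => tanh (w z)) 0 :=
    (analyticAt_tanh (cosh_ne_zero_of_abs_im_lt (abs_im_lt_pi_div_two_of_mem_unitDisk hw0))).comp hw
  rw [← taylorSeries_mul hQ hQ, ← taylorSeries_one, ← taylorSeries_add analyticAt_const hT]
  simp_rw [beanMap_mul_self]

theorem X_mul_derivative_derivative_taylorSeries {φ : ℂ → ℂ} (hf : AnalyticAt ℂ f 0)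
    (hf' : deriv f 0 ≠ 0) (hφ : AnalyticAt ℂ φ 0)
    (h : ∀ᶠ z in 𝓝 0, 1 + z * deriv (deriv f) z / deriv f z = φ z) :
    X * d⁄dX ℂ (d⁄dX ℂ (taylorSeries f)) = d⁄dX ℂ (taylorSeries f) * (taylorSeries φ - 1) := by
  have hODE : (fun z => z * deriv (deriv f) z) =ᶠ[𝓝 0] fun z => deriv f z * (φ z - 1) := by
    filter_upwards [h, hf.deriv.continuousAt.eventually_ne hf'] with z hz hz'
    rw [← hz]
    field_simp
    ring
  rw [← taylorSeries_deriv, ← taylorSeries_deriv, ← taylorSeries_id, ← taylorSeries_one,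
    ← taylorSeries_sub hφ analyticAt_const,
    ← taylorSeries_mul hf.deriv (hφ.fun_sub analyticAt_const),
    ← taylorSeries_mul (f := fun z => z) analyticAt_id hf.deriv.deriv, taylorSeries_congr hODE]

theorem taylorCoeff_of_one_add_eq_beanMap_comp (hf : AnalyticAt ℂ f 0) (hf' : deriv f 0 = 1)
    (hw : AnalyticAt ℂ w 0) (hw0 : w 0 = 0)
    (h : ∀ᶠ z in 𝓝 0, 1 + z * deriv (deriv f) z / deriv f z = beanMap (w z)) :
    taylorCoeff f 2 = taylorCoeff w 1 / 4 ∧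
      taylorCoeff f 3 = taylorCoeff w 1 ^ 2 / 48 + taylorCoeff w 2 / 12 ∧
      taylorCoeff f 4 = -13 / 1152 * taylorCoeff w 1 ^ 3 + taylorCoeff w 1 * taylorCoeff w 2 / 96
        + taylorCoeff w 3 / 24 ∧
      taylorCoeff f 5 = -11 / 5760 * taylorCoeff w 1 ^ 4
        - taylorCoeff w 1 ^ 2 * taylorCoeff w 2 / 48 + taylorCoeff w 1 * taylorCoeff w 3 / 240
        + taylorCoeff w 4 / 40 := by
  have hw0' : w 0 ∈ unitDisk := by simp [hw0, unitDisk]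
  obtain ⟨t1, t2, t3, t4⟩ := coeff_of_derivative_eq_one_sub_mul_self
    (derivative_taylorSeries_tanh_comp hw (by simp [hw0])) (by simp [taylorCoeff_zero, hw0])
  obtain ⟨q1, q2, q3, q4⟩ := coeff_of_mul_self_eq_one_add
    (taylorSeries_beanMap_comp_mul_self hw hw0')
    (by simp [taylorCoeff_zero, hw0, beanMap_zero])
  obtain ⟨f2, f3, f4, f5⟩ := coeff_of_X_mul_derivative_derivative_eq
    (X_mul_derivative_derivative_taylorSeries hf (by simp [hf'])
      (analyticAt_beanMap_comp hw hw0') h)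
    (by simp [taylorCoeff_one, hf'])
  simp only [coeff_taylorSeries] at t1 t2 t3 t4 q1 q2 q3 q4 f2 f3 f4 f5
  rw [t1] at q1
  rw [t1, t2] at q2
  rw [t1, t2, t3] at q3
  rw [t1, t2, t3, t4] at q4
  rw [f2, f3, f4, f5, q1, q2, q3, q4]
  refine ⟨?_, ?_, ?_, ?_⟩ <;> ring

/-- The polynomial in the coefficients `c₁, …, c₄` of the Schwarz function of `f ∈ 𝒞_ℬ` which
equals `576 H₃(1)`. -/
def hankelPoly (c₁ c₂ c₃ c₄ : ℂ) : ℂ :=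
  -c₃ ^ 2 + 6 / 5 * (c₂ * c₄) - 1 / 3 * c₂ ^ 3 + 7 / 10 * (c₁ * c₂ * c₃) - 3 / 5 * (c₁ ^ 2 * c₄)
    - 17 / 16 * (c₁ ^ 2 * c₂ ^ 2) + 83 / 120 * (c₁ ^ 3 * c₃) + 131 / 480 * (c₁ ^ 4 * c₂)
    - 1157 / 11520 * c₁ ^ 6

theorem hankelDet_three_one (f : ℂ → ℂ) :
    hankelDet 3 1 f =
      2 * taylorCoeff f 2 * taylorCoeff f 3 * taylorCoeff f 4 - taylorCoeff f 3 ^ 3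
        - taylorCoeff f 1 * taylorCoeff f 4 ^ 2 - taylorCoeff f 2 ^ 2 * taylorCoeff f 5
        + taylorCoeff f 1 * taylorCoeff f 3 * taylorCoeff f 5 := by
  simp only [hankelDet, Matrix.det_fin_three, Matrix.of_apply, Fin.coe_ofNat_eq_mod, Nat.zero_mod,
    add_zero, Nat.one_mod, Nat.reduceAdd, Nat.mod_succ]
  ring

theorem hankelDet_eq_hankelPoly (hf : AnalyticAt ℂ f 0) (hf' : deriv f 0 = 1)
    (hw : AnalyticAt ℂ w 0) (hw0 : w 0 = 0)
    (h : ∀ᶠ z in 𝓝 0, 1 + z * deriv (deriv f) z / deriv f z = beanMap (w z)) :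
    576 * hankelDet 3 1 f = hankelPoly (taylorCoeff w 1) (taylorCoeff w 2) (taylorCoeff w 3)
      (taylorCoeff w 4) := by
  obtain ⟨a2, a3, a4, a5⟩ := taylorCoeff_of_one_add_eq_beanMap_comp hf hf' hw hw0 h
  rw [hankelDet_three_one, taylorCoeff_one, hf', a2, a3, a4, a5, hankelPoly]
  ring

end LocalExpansion

/-! ### The upper bound -/

/-- The polynomial `hankelPoly` with its coefficients replaced by their absolute values. -/
def hankelMajorant (a b c d : ℝ) : ℝ :=
  c ^ 2 + 6 / 5 * (b * d) + 1 / 3 * b ^ 3 + 7 / 10 * (a * b * c) + 3 / 5 * (a ^ 2 * d)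
    + 17 / 16 * (a ^ 2 * b ^ 2) + 83 / 120 * (a ^ 3 * c) + 131 / 480 * (a ^ 4 * b)
    + 1157 / 11520 * a ^ 6

theorem norm_hankelPoly_le (c₁ c₂ c₃ c₄ : ℂ) :
    ‖hankelPoly c₁ c₂ c₃ c₄‖ ≤ hankelMajorant ‖c₁‖ ‖c₂‖ ‖c₃‖ ‖c₄‖ := by
  refine norm_sub_le_of_le (norm_add_le_of_le (norm_add_le_of_le (norm_sub_le_of_le
    (norm_sub_le_of_le (norm_add_le_of_le (norm_sub_le_of_le (norm_add_le_of_le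
    ?_ ?_) ?_) ?_) ?_) ?_) ?_) ?_) ?_ <;> simp

theorem hankelMajorant_le_one {a b c d : ℝ} (h : a ^ 2 + b ^ 2 + c ^ 2 + d ^ 2 ≤ 1) :
    hankelMajorant a b c d ≤ 1 := by
  have ha : a ^ 2 ≤ 1 := by linarith [sq_nonneg b, sq_nonneg c, sq_nonneg d]
  have ha4 : 0 ≤ (a ^ 2) ^ 2 * (1 - a ^ 2) := mul_nonneg (sq_nonneg _) (sub_nonneg.2 ha)
  have hbd : 6 / 5 * (b * d) ≤ 9 / 25 * b ^ 2 + d ^ 2 := by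
    linear_combination sq_nonneg (3 / 5 * b - d)
  have hb3 : 1 / 3 * b ^ 3 ≤ 1 / 12 * b ^ 2 + 1 / 3 * (b ^ 2) ^ 2 := by
    linear_combination 1 / 12 * sq_nonneg (b - 2 * b ^ 2)
  have habc : 7 / 10 * (a * b * c) ≤
      7 / 80 * (a ^ 2 + b ^ 2) + 7 / 20 * (a ^ 2 + b ^ 2) * c ^ 2 := by
    linear_combination 7 / 80 * sq_nonneg (a - 2 * b * c) + 7 / 80 * sq_nonneg (b - 2 * a * c)
  have ha2d : 3 / 5 * (a ^ 2 * d) ≤ 3 / 20 * a ^ 2 + 3 / 5 * (a ^ 2 * d ^ 2) := by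
    linear_combination 3 / 20 * sq_nonneg (a - 2 * a * d)
  have ha3c : 83 / 120 * (a ^ 3 * c) ≤ 83 / 240 * ((a ^ 2) ^ 2 + a ^ 2 * c ^ 2) := by
    linear_combination 83 / 240 * sq_nonneg (a ^ 2 - a * c)
  have ha4b : 131 / 480 * (a ^ 4 * b) ≤ 131 / 960 * ((a ^ 2) ^ 2 + a ^ 2 * b ^ 2) := by
    linear_combination 131 / 960 * (a ^ 2 * sq_nonneg (a ^ 2 - b) + ha4)
  -- The slack in the constraint, multiplied by `a²` and `b²`, absorbs all quartic terms.
  have hA : a ^ 2 * (a ^ 2 + b ^ 2 + c ^ 2 + d ^ 2) ≤ a ^ 2 :=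
    mul_le_of_le_one_right (sq_nonneg a) h
  have hB : b ^ 2 * (a ^ 2 + b ^ 2 + c ^ 2 + d ^ 2) ≤ b ^ 2 :=
    mul_le_of_le_one_right (sq_nonneg b) h
  have sq_mul_sq_nonneg (x y : ℝ) : 0 ≤ x ^ 2 * y ^ 2 := by positivity
  unfold hankelMajorant
  linarith [sq_mul_sq_nonneg a a, sq_mul_sq_nonneg a b, sq_mul_sq_nonneg a c,
    sq_mul_sq_nonneg a d, sq_mul_sq_nonneg b b, sq_mul_sq_nonneg b c, sq_mul_sq_nonneg b d]

theorem norm_hankelPoly_le_one {c₁ c₂ c₃ c₄ : ℂ}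
    (h : ‖c₁‖ ^ 2 + ‖c₂‖ ^ 2 + ‖c₃‖ ^ 2 + ‖c₄‖ ^ 2 ≤ 1) : ‖hankelPoly c₁ c₂ c₃ c₄‖ ≤ 1 :=
  (norm_hankelPoly_le c₁ c₂ c₃ c₄).trans (hankelMajorant_le_one h)

theorem IsSchwarz.mapsTo {w : ℂ → ℂ} (hw : IsSchwarz w) : MapsTo w unitDisk unitDisk :=
  fun z hz => mem_ball_zero_iff.2 ((hw.2.2 z hz).trans_lt (mem_ball_zero_iff.1 hz))

theorem IsSchwarz.sum_norm_taylorCoeff_sq_le_one {w : ℂ → ℂ} (hw : IsSchwarz w) (s : Finset ℕ) :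
    ∑ n ∈ s, ‖taylorCoeff w n‖ ^ 2 ≤ 1 := by
  simpa using sum_norm_taylorCoeff_mul_pow_sq_le one_pos hw.1
    (fun z hz => (mem_ball_zero_iff.1 (hw.mapsTo hz)).le) s

theorem hankelDet_eq_hankelPoly_of_isSchwarz {f w : ℂ → ℂ} (hf : f ∈ ClassA) (hw : IsSchwarz w)
    (h : ∀ z ∈ unitDisk, 1 + z * deriv (deriv f) z / deriv f z = beanMap (w z)) :
    576 * hankelDet 3 1 f = hankelPoly (taylorCoeff w 1) (taylorCoeff w 2) (taylorCoeff w 3)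
      (taylorCoeff w 4) :=
  hankelDet_eq_hankelPoly (hf.1.analyticAt unitDisk_mem_nhds_zero) hf.2.2
    (hw.1.analyticAt unitDisk_mem_nhds_zero) hw.2.1 (eventually_of_mem unitDisk_mem_nhds_zero h)

theorem norm_hankelDet_le {f : ℂ → ℂ} (hf : f ∈ ClassCB) : ‖hankelDet 3 1 f‖ ≤ 1 / 576 := by
  obtain ⟨hfA, -, -, w, hw, h⟩ := hf
  have hsum := hw.sum_norm_taylorCoeff_sq_le_one {1, 2, 3, 4}
  have hle : ‖576 * hankelDet 3 1 f‖ ≤ 1 := by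
    rw [hankelDet_eq_hankelPoly_of_isSchwarz hfA hw h]
    exact norm_hankelPoly_le_one (by simpa [add_assoc] using hsum)
  rw [norm_mul, norm_ofNat] at hle
  linarith

/-! ### Sharpness -/

theorem segmentIntegral_zero (g : ℂ → ℂ) : segmentIntegral g 0 = 0 := by simp [segmentIntegral]

theorem segmentIntegral_eq_sub_of_hasDerivAt {g G : ℂ → ℂ} {s : Set ℂ} (hs : StarConvex ℝ 0 s)
    (hg : ContinuousOn g s) (hG : ∀ x ∈ s, HasDerivAt G (g x) x) {z : ℂ} (hz : z ∈ s) :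
    segmentIntegral g z = G z - G 0 := by
  have hmem : ∀ t ∈ Icc (0 : ℝ) 1, 0 + t • z ∈ s := fun t ht => by
    simpa using starConvex_zero_iff.1 hs hz ht.1 ht.2
  have h := intervalIntegral.integral_unitInterval_deriv_eq_sub
    (hg.comp (by fun_prop) hmem) fun t ht => hG _ (hmem t ht)
  simpa [segmentIntegral] using h

theorem hasDerivAt_segmentIntegral {g : ℂ → ℂ} {R : ℝ} (hg : DifferentiableOn ℂ g (ball 0 R))
    {z : ℂ} (hz : z ∈ ball 0 R) : HasDerivAt (segmentIntegral g) (g z) z := by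
  obtain ⟨G, hG⟩ := hg.isExactOn_ball
  have hstar : StarConvex ℝ 0 (ball (0 : ℂ) R) :=
    (convex_ball 0 R).starConvex (mem_ball_self (pos_of_mem_ball hz))
  refine ((hG z hz).sub_const (G 0)).congr_of_eventuallyEq ?_
  filter_upwards [isOpen_ball.mem_nhds hz] with x hx
    using segmentIntegral_eq_sub_of_hasDerivAt hstar hg.continuousOn hG hx

theorem segmentIntegral_sub_div (φ : ℂ → ℂ) :
    segmentIntegral (fun u => (φ u - φ 0) / u) = segmentIntegral (dslope φ 0) := by
  funext z
  obtain rfl | hz := eq_or_ne z 0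
  · simp only [segmentIntegral_zero]
  · unfold segmentIntegral
    congr 1
    refine intervalIntegral.integral_congr_uIoo fun s hs => ?_
    have hs0 : (s : ℂ) ≠ 0 := by
      rw [uIoo_of_le zero_le_one] at hs
      exact_mod_cast hs.1.ne'
    simp [dslope_of_ne, slope_def_field, hs0, hz]

/-- The solution of `1 + z f'' / f' = φ` with `f 0 = 0` and `f' 0 = 1`, for `φ` analytic with
`φ 0 = 1`. -/
def convexIntegral (φ : ℂ → ℂ) : ℂ → ℂ :=
  segmentIntegral fun t => exp (segmentIntegral (fun u => (φ u - 1) / u) t)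

section ConvexIntegral

variable {φ : ℂ → ℂ} {R : ℝ} {z : ℂ}

theorem hasDerivAt_segmentIntegral_sub_one_div (hφ : DifferentiableOn ℂ φ (ball 0 R))
    (hφ0 : φ 0 = 1) (hz : z ∈ ball 0 R) :
    HasDerivAt (segmentIntegral fun u => (φ u - 1) / u) (dslope φ 0 z) z := by
  have hslope : DifferentiableOn ℂ (dslope φ 0) (ball 0 R) :=
    (differentiableOn_dslope (ball_mem_nhds 0 (pos_of_mem_ball hz))).2 hφ
  rw [← hφ0, segmentIntegral_sub_div]
  exact hasDerivAt_segmentIntegral hslope hz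

theorem hasDerivAt_convexIntegral (hφ : DifferentiableOn ℂ φ (ball 0 R)) (hφ0 : φ 0 = 1)
    (hz : z ∈ ball 0 R) :
    HasDerivAt (convexIntegral φ) (exp (segmentIntegral (fun u => (φ u - 1) / u) z)) z :=
  hasDerivAt_segmentIntegral (fun _ hx =>
    (hasDerivAt_segmentIntegral_sub_one_div hφ hφ0 hx).cexp.differentiableAt
      |>.differentiableWithinAt) hz

theorem deriv_deriv_convexIntegral (hφ : DifferentiableOn ℂ φ (ball 0 R)) (hφ0 : φ 0 = 1)
    (hz : z ∈ ball 0 R) :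
    deriv (deriv (convexIntegral φ)) z = deriv (convexIntegral φ) z * dslope φ 0 z := by
  have hderiv : deriv (convexIntegral φ) =ᶠ[𝓝 z]
      fun x => exp (segmentIntegral (fun u => (φ u - 1) / u) x) := by
    filter_upwards [isOpen_ball.mem_nhds hz] with x hx
      using (hasDerivAt_convexIntegral hφ hφ0 hx).deriv
  rw [hderiv.deriv_eq, hderiv.eq_of_nhds,
    (hasDerivAt_segmentIntegral_sub_one_div hφ hφ0 hz).cexp.deriv]

theorem one_add_mul_deriv_deriv_convexIntegral_div (hφ : DifferentiableOn ℂ φ (ball 0 R))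
    (hφ0 : φ 0 = 1) (hz : z ∈ ball 0 R) :
    1 + z * deriv (deriv (convexIntegral φ)) z / deriv (convexIntegral φ) z = φ z := by
  have hne : deriv (convexIntegral φ) z ≠ 0 := by
    rw [(hasDerivAt_convexIntegral hφ hφ0 hz).deriv]
    exact exp_ne_zero _
  have hslope : z * dslope φ 0 z = φ z - 1 := by
    simpa [hφ0] using sub_smul_dslope φ 0 z
  rw [deriv_deriv_convexIntegral hφ hφ0 hz, mul_left_comm, mul_div_cancel_left₀ _ hne, hslope,
    add_sub_cancel]

end ConvexIntegral

theorem convexIntegral_mem_classA {φ : ℂ → ℂ} (hφ : DifferentiableOn ℂ φ unitDisk)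
    (hφ0 : φ 0 = 1) : convexIntegral φ ∈ ClassA := by
  have hderiv (z : ℂ) (hz : z ∈ unitDisk) := hasDerivAt_convexIntegral hφ hφ0 hz
  refine ⟨fun z hz => (hderiv z hz).differentiableAt.differentiableWithinAt,
    segmentIntegral_zero _, ?_⟩
  rw [(hderiv 0 (mem_ball_self one_pos)).deriv, segmentIntegral_zero, exp_zero]

section SchwarzFunction

variable {w : ℂ → ℂ}

theorem IsSchwarz.differentiableOn_beanMap_comp (hw : IsSchwarz w) :
    DifferentiableOn ℂ (fun z => beanMap (w z)) unitDisk :=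
  differentiableOn_beanMap.comp hw.1 hw.mapsTo

theorem IsSchwarz.beanMap_apply_zero (hw : IsSchwarz w) : beanMap (w 0) = 1 := by
  rw [hw.2.1, beanMap_zero]

theorem convexIntegral_beanMap_comp_mem_classCB (hw : IsSchwarz w) :
    convexIntegral (fun z => beanMap (w z)) ∈ ClassCB := by
  have hφ := hw.differentiableOn_beanMap_comp
  have hsub : ∀ z ∈ unitDisk, _ := fun z hz =>
    one_add_mul_deriv_deriv_convexIntegral_div hφ hw.beanMap_apply_zero hz
  exact ⟨convexIntegral_mem_classA hφ hw.beanMap_apply_zero, hφ.congr hsub,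
    differentiableOn_beanMap, w, hw, hsub⟩

theorem hankelDet_convexIntegral_beanMap_comp (hw : IsSchwarz w) :
    576 * hankelDet 3 1 (convexIntegral fun z => beanMap (w z)) =
      hankelPoly (taylorCoeff w 1) (taylorCoeff w 2) (taylorCoeff w 3) (taylorCoeff w 4) :=
  hankelDet_eq_hankelPoly_of_isSchwarz (convexIntegral_beanMap_comp_mem_classCB hw).1 hw
    fun _ hz => one_add_mul_deriv_deriv_convexIntegral_div hw.differentiableOn_beanMap_comp
      hw.beanMap_apply_zero hz

end SchwarzFunction

theorem isSchwarz_pow {k : ℕ} (hk : k ≠ 0) : IsSchwarz fun z => z ^ k := by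
  refine ⟨by fun_prop, zero_pow hk, fun z hz => ?_⟩
  rw [norm_pow]
  exact pow_le_of_le_one (norm_nonneg z) (mem_ball_zero_iff.1 hz).le hk

theorem extremalFun_eq_convexIntegral :
    extremalFun = convexIntegral fun z => beanMap (z ^ 3) := rfl

theorem extremalFun_mem_classCB : extremalFun ∈ ClassCB :=
  convexIntegral_beanMap_comp_mem_classCB (isSchwarz_pow three_ne_zero)

theorem norm_hankelDet_extremalFun : ‖hankelDet 3 1 extremalFun‖ = 1 / 576 := by
  have h : 576 * hankelDet 3 1 extremalFun = -1 := by
    rw [extremalFun_eq_convexIntegral,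
      hankelDet_convexIntegral_beanMap_comp (isSchwarz_pow three_ne_zero)]
    simp [taylorCoeff_pow, hankelPoly]
  have hnorm := congrArg norm h
  rw [norm_mul, norm_ofNat, norm_neg, norm_one] at hnorm
  linarith

end BeanConvex

end

theorem mainTheorem3 :
    (∀ f ∈ BeanConvex.ClassCB, ‖BeanConvex.hankelDet 3 1 f‖ ≤ 1 / 576) ∧
      BeanConvex.extremalFun ∈ BeanConvex.ClassCB ∧
      ‖BeanConvex.hankelDet 3 1 BeanConvex.extremalFun‖ = 1 / 576 :=
  ⟨fun _ hf => BeanConvex.norm_hankelDet_le hf, BeanConvex.extremalFun_mem_classCB,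
    BeanConvex.norm_hankelDet_extremalFun⟩
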